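/- Let $k\ge 0$ and $n\ge k+2$ be integers and let $R>0$, $D>0$. Write $z=(x,y)\in\mathbb R^n\times\mathbb R^n$ with the Euclidean norm. A function $L:\mathbb R^n\times\mathbb R^n\to\mathbb R$ is \emph{biaffine} if it is affine in $x$ for each fixed $y$ and affine in $y$ for each fixed $x$, and \emph{$R$-smooth} if it is differentiable and $z\mapsto(\nabla_xL(z),-\nabla_yL(z))$ is $R$-Lipschitz; it is convex-concave if it is convex in $x$ and concave in $y$. A point $(x^\star,y^\star)$ is a saddle point of $L$ if $L(x^\star,y)\le L(x^\star,y^\star)\le L(x,y^\star)$ for all $x,y$. A (deterministic) algorithm $\mathcal A$ produces, from a starting point $z^0$ and a function $L$, the iterates $z^j=\mathcal A(z^0,\dots,z^{j-1};L)$, $j\ge1$. Let $\mathfrak A_{\mathrm{sep}}$ be the class of all algorithms such that, for every smooth convex-concave $L$ (i.e. convex-concave and $R'$-smooth for some $R'$), every $z^0$ and every $j$, $$x^j\in x^0+\mathrm{span}\{\nabla_xL(z^0),\dots,\nabla_xL(z^{j-1})\},\qquad y^j\in y^0+\mathrm{span}\{\nabla_yL(z^0),\dots,\nabla_yL(z^{j-1})\}.$$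 (i) For every starting point $z^0$ there is an $R$-smooth biaffine function $L$ on $\mathbb R^n\times\mathbb R^n$ which has a saddle point, whose saddle point $z^\star$ closest to $z^0$ satisfies $\|z^0-z^\star\|=D$, and for which $$\|\nabla L(z^k)\|^2\ \ge\ \frac{R^2\|z^0-z^\star\|^2}{(2\lfloor k/2\rfloor+1)^2}$$ holds for the $k$-th iterate $z^k$ of every algorithm in $\mathfrak A_{\mathrm{sep}}$ started at $z^0$ and applied to $L$. (ii) This lower bound cannot be improved with biaffine functions: $$\inf_{\mathcal A\in\mathfrak A_{\mathrm{sep}}}\ \sup_{L,\,z^0}\ \|\nabla L(z^k)\|^2\ =\ \frac{R^2D^2}{(2\lfloor k/2\rfloor+1)^2},$$ where the supremum is over all $R$-smooth biaffine functions $L$ on $\mathbb R^n\times\mathbb R^n$ and all $z^0$ at distance at most $D$ from some saddle point of $L$, and $z^k$ is the $k$-th iterate of $\mathcal A$ applied to $L$ from $z^0$. The equality remains true if the infimum is restricted to those algorithms in $\mathfrak A_{\mathrm{sep}}$ that access $L$ only through its gradients at the previous iterates. -/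

import Mathlib

open scoped ENNReal

noncomputable section

namespace Minimax

/-- `ℝⁿ` with its Euclidean norm. -/
abbrev Vec (n : ℕ) : Type := EuclideanSpace ℝ (Fin n)

/-- `ℝⁿ × ℝⁿ` with the Euclidean norm `‖(x, y)‖² = ‖x‖² + ‖y‖²`; its points are `z = (x, y)`. -/
abbrev Pt (n : ℕ) : Type := WithLp 2 (Vec n × Vec n)

/-- Saddle functions `L(x, y)` on `ℝⁿ × ℝⁿ`. -/
abbrev SaddleFun (n : ℕ) : Type := Vec n → Vec n → ℝ

variable {n : ℕ}

/-- The partial gradient `∇ₓ L (x, y)` at `z = (x, y)`. -/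
def gradX (L : SaddleFun n) (z : Pt n) : Vec n := gradient (fun x => L x z.snd) z.fst

/-- The partial gradient `∇_y L (x, y)` at `z = (x, y)`. -/
def gradY (L : SaddleFun n) (z : Pt n) : Vec n := gradient (fun y => L z.fst y) z.snd

/-- The full gradient `∇L(z) = (∇ₓ L(z), ∇_y L(z))`. -/
def grad (L : SaddleFun n) (z : Pt n) : Pt n := WithLp.toLp 2 (gradX L z, gradY L z)

/-- The saddle operator `G_L(z) = (∇ₓ L(z), -∇_y L(z))`. -/
def saddleOp (L : SaddleFun n) (z : Pt n) : Pt n := WithLp.toLp 2 (gradX L z, -gradY L z)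

/-- `L` is `R`-smooth: it is differentiable and its saddle operator is `R`-Lipschitz. -/
def IsSmooth (R : ℝ) (L : SaddleFun n) : Prop :=
  Differentiable ℝ (fun p : Vec n × Vec n => L p.1 p.2) ∧
    ∀ z w : Pt n, ‖saddleOp L z - saddleOp L w‖ ≤ R * ‖z - w‖

/-- `L` is convex in `x` for each fixed `y` and concave in `y` for each fixed `x`. -/
def IsConvexConcave (L : SaddleFun n) : Prop :=
  (∀ y, ConvexOn ℝ Set.univ (fun x => L x y)) ∧ (∀ x, ConcaveOn ℝ Set.univ (fun y => L x y))

/-- `L` is affine in `x` for each fixed `y` and affine in `y` for each fixed `x`. -/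
def IsBiaffine (L : SaddleFun n) : Prop :=
  (∀ y, ∃ f : Vec n →ᵃ[ℝ] ℝ, ∀ x, L x y = f x) ∧
    (∀ x, ∃ f : Vec n →ᵃ[ℝ] ℝ, ∀ y, L x y = f y)

/-- The class of `R`-smooth biaffine functions on `ℝⁿ × ℝⁿ`. -/
def smoothBiaffine (n : ℕ) (R : ℝ) : Set (SaddleFun n) := {L | IsBiaffine L ∧ IsSmooth R L}

/-- `z⋆ = (x⋆, y⋆)` is a saddle point: `L(x⋆, y) ≤ L(x⋆, y⋆) ≤ L(x, y⋆)` for all `x`, `y`. -/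
def IsSaddlePoint (L : SaddleFun n) (zs : Pt n) : Prop :=
  ∀ x y : Vec n, L zs.fst y ≤ L zs.fst zs.snd ∧ L zs.fst zs.snd ≤ L x zs.snd

/-- `z⋆` is a saddle point of `L` closest to `z⁰`. -/
def IsClosestSaddlePoint (L : SaddleFun n) (z0 zs : Pt n) : Prop :=
  IsSaddlePoint L zs ∧ ∀ w, IsSaddlePoint L w → ‖z0 - zs‖ ≤ ‖z0 - w‖

/-- A deterministic algorithm: given the saddle function `L` and the points `z⁰, …, zʲ`, it
returns the next point `zʲ⁺¹ = 𝒜(z⁰, …, zʲ; L)`. -/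
abbrev Algorithm (n : ℕ) : Type := SaddleFun n → (j : ℕ) → (Fin (j + 1) → Pt n) → Pt n

/-- The iterates `zʲ` produced by an algorithm on `L` from the starting point `z⁰`. -/
def iterate (A : Algorithm n) (L : SaddleFun n) (z0 : Pt n) : ℕ → Pt n
  | 0 => z0
  | j + 1 => A L j (fun i : Fin (j + 1) => iterate A L z0 i)
termination_by j => j
decreasing_by exact i.isLt

/-- The class `𝔄_sep`: on every smooth convex-concave `L` and from every `z⁰`, each iterate satisfies
`xʲ ∈ x⁰ + span {∇ₓ L(zⁱ) : i < j}` and `yʲ ∈ y⁰ + span {∇_y L(zⁱ) : i < j}`. -/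
def algSep (n : ℕ) : Set (Algorithm n) :=
  {A | ∀ L : SaddleFun n, IsConvexConcave L → (∃ R, IsSmooth R L) → ∀ (z0 : Pt n) (j : ℕ),
    (iterate A L z0 j).fst - z0.fst ∈
        Submodule.span ℝ ((fun i => gradX L (iterate A L z0 i)) '' Set.Iio j) ∧
      (iterate A L z0 j).snd - z0.snd ∈
        Submodule.span ℝ ((fun i => gradY L (iterate A L z0 i)) '' Set.Iio j)}

/-- The algorithms that access `L` only through its gradients at the previous iterates. -/
def algGradientBased (n : ℕ) : Set (Algorithm n) :=
  {A | ∀ (L L' : SaddleFun n) (j : ℕ) (h : Fin (j + 1) → Pt n),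
    (∀ i, gradX L (h i) = gradX L' (h i) ∧ gradY L (h i) = gradY L' (h i)) → A L j h = A L' j h}

/-- The worst-case complexity of `A` on the class `F` after `k` iterations: the supremum of
`‖∇L(zᵏ)‖²` over all `L ∈ F` and all `z⁰` at distance at most `D` from a saddle point of `L`. -/
def worstCase (A : Algorithm n) (F : Set (SaddleFun n)) (D : ℝ) (k : ℕ) : ℝ≥0∞ :=
  ⨆ (L : SaddleFun n) (_ : L ∈ F) (z0 : Pt n)
    (_ : ∃ zs, IsSaddlePoint L zs ∧ ‖z0 - zs‖ ≤ D),
    ENNReal.ofReal (‖grad L (iterate A L z0 k)‖ ^ 2)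

/-- The optimal complexity lower bound of the algorithm class `𝔄` on the function class `F`. -/
def optimalComplexity (𝔄 : Set (Algorithm n)) (F : Set (SaddleFun n)) (D : ℝ) (k : ℕ) : ℝ≥0∞ :=
  ⨅ (A : Algorithm n) (_ : A ∈ 𝔄), worstCase A F D k

end Minimax

end

/-! Recentred at a saddle point `zs`, the saddle operator of a biaffine function is a linear skew
map `G` with `‖G u‖ ≤ R ‖u‖`, so `S = -G²` is symmetric with spectrum in `[0, R²]`. Since `‖∇L‖² =
⟪S w, w⟫` for the error `w`, both bounds reduce to one extremal problem: among polynomials `p` of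
degree at most `m = k / 2` with `p 0 = 1`, make `t * p (t²)` smallest on `[0, 1]`. The minimizer is
`cheb m / (2m+1)`, with value `1 / (2m+1)`.

Upper bound: `chebAlg` runs the three-term recurrence of `cheb` in `S / R²`, two gradients per
application of `S` (`inner_iterate_chebAlg`, `norm_grad_iterate_chebAlg_sq_le`).

Lower bound: take the bilinear coupling `R T` with `T` diagonal and an initial error `u` in `x`
only. Information alternates between the blocks, so the `x`-error after `k` steps is `p (T²) u` with
`p` as above (`exists_poly_le_norm_grad_sq`). With Chebyshev nodes as entries of `T`, and `u` given
by the dual extremal functional, no such `p` does better (`chebyshev_mean_sq_lower_bound`). This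
instance does not depend on the algorithm. -/

noncomputable section

namespace Minimax

/-! ### Odd Chebyshev polynomials and their dual extremal functional. -/

section

open Polynomial

/-- The polynomial `P` of degree `m` with `sin ((2m+1)φ) = sin φ * P (sin² φ)`. -/
def cheb : ℕ → ℝ[X]
  | 0 => 1
  | 1 => 3 - 4 * X
  | m + 2 => 2 * (1 - 2 * X) * cheb (m + 1) - cheb m

/-- The recurrence is `sin (a + 2φ) + sin (a - 2φ) = 2 cos (2φ) sin a` with `cos (2φ) = 1 - 2 sin²
φ`. -/
lemma sin_mul_eval_cheb (φ : ℝ) (m : ℕ) :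
    Real.sin φ * (cheb m).eval (Real.sin φ ^ 2) = Real.sin ((2 * m + 1) * φ) := by
  induction m using Nat.twoStepInduction with
  | zero => simp [cheb]
  | one =>
    have h := Real.sin_three_mul φ
    simp only [cheb, eval_sub, eval_mul, eval_X, eval_ofNat]
    norm_num
    rw [h]; ring
  | more m ih₁ ih₂ =>
    have h₁ : (2 * ((m + 2 : ℕ) : ℝ) + 1) * φ = (2 * (m + 1) + 1) * φ + 2 * φ := by push_cast; ring
    have h₂ : (2 * (m : ℝ) + 1) * φ = (2 * (m + 1) + 1) * φ - 2 * φ := by ring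
    rw [h₂, Real.sin_sub] at ih₁
    rw [h₁, Real.sin_add]
    push_cast at ih₂
    have h₃ : Real.cos (2 * φ) = 1 - 2 * Real.sin φ ^ 2 := by
      rw [Real.cos_two_mul, Real.cos_sq']; ring
    simp only [cheb, eval_sub, eval_mul, eval_X, eval_ofNat, eval_one]
    rw [h₃] at ih₁ ⊢
    linear_combination 2 * (1 - 2 * Real.sin φ ^ 2) * ih₂ - ih₁

lemma eval_cheb_zero (m : ℕ) : (cheb m).eval 0 = 2 * m + 1 := by
  induction m using Nat.twoStepInduction with
  | zero => simp [cheb]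
  | one => simp [cheb]; norm_num
  | more m ih₁ ih₂ => simp [cheb, ih₁, ih₂]; ring

lemma X_mul_mem_degreeLT {d : ℕ} {p : ℝ[X]} (hp : p ∈ degreeLT ℝ d) :
    X * p ∈ degreeLT ℝ (d + 1) := by
  rw [mem_degreeLT, degree_lt_iff_coeff_zero] at *
  intro i hi
  obtain ⟨i, rfl⟩ : ∃ l, i = l + 1 := ⟨i - 1, by omega⟩
  rw [coeff_X_mul]
  exact hp i (by omega)

lemma one_mem_degreeLT (d : ℕ) : (1 : ℝ[X]) ∈ degreeLT ℝ (d + 1) :=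
  degreeLT_mono (show 1 ≤ d + 1 by omega) (by simp [mem_degreeLT])

lemma cheb_mem_degreeLT (m : ℕ) : cheb m ∈ degreeLT ℝ (m + 1) := by
  induction m using Nat.twoStepInduction with
  | zero => simpa [cheb] using one_mem_degreeLT 0
  | one =>
    have : cheb 1 = (3 : ℝ) • (1 : ℝ[X]) - (4 : ℝ) • (X * 1) := by
      simp only [cheb, smul_eq_C_mul, map_ofNat, mul_one]
    rw [this]
    exact Submodule.sub_mem _ (Submodule.smul_mem _ _ (one_mem_degreeLT 1))
      (Submodule.smul_mem _ _ (X_mul_mem_degreeLT (one_mem_degreeLT 0)))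
  | more m ih₁ ih₂ =>
    have : cheb (m + 2) = (2 : ℝ) • cheb (m + 1) - (4 : ℝ) • (X * cheb (m + 1)) - cheb m := by
      simp only [cheb, smul_eq_C_mul, map_ofNat]; ring
    rw [this]
    exact Submodule.sub_mem _ (Submodule.sub_mem _
      (Submodule.smul_mem _ _ (degreeLT_mono (by omega) ih₂))
      (Submodule.smul_mem _ _ (X_mul_mem_degreeLT ih₂))) (degreeLT_mono (by omega) ih₁)

lemma mul_eval_cheb_sq_le (m : ℕ) {s : ℝ} (h0 : 0 ≤ s) (h1 : s ≤ 1) :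
    s * (cheb m).eval s ^ 2 ≤ 1 := by
  have hs : Real.sin (Real.arcsin √s) = √s :=
    Real.sin_arcsin (by linarith [Real.sqrt_nonneg s]) (Real.sqrt_le_one.mpr h1)
  have h := sin_mul_eval_cheb (Real.arcsin √s) m
  rw [hs, Real.sq_sqrt h0] at h
  calc s * (cheb m).eval s ^ 2 = (√s * (cheb m).eval s) ^ 2 := by
        rw [mul_pow, Real.sq_sqrt h0]
    _ ≤ 1 := by rw [h]; exact Real.sin_sq_le_one _

/-- The angles at which `sin ((2m+1)φ)` alternates between `1` and `-1`. -/
def chebAngle (m j : ℕ) : ℝ := (2 * j + 1) * Real.pi / (2 * (2 * m + 1))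

/-- The positive extremal points of the Chebyshev polynomial of degree `2m+1`. -/
def chebNode (m j : ℕ) : ℝ := Real.sin (chebAngle m j)

lemma chebAngle_pos (m j : ℕ) : 0 < chebAngle m j := by
  unfold chebAngle; positivity

lemma chebAngle_le {m j : ℕ} (hj : j ≤ m) : chebAngle m j ≤ Real.pi / 2 := by
  have : (j : ℝ) ≤ m := by exact_mod_cast hj
  unfold chebAngle
  rw [div_le_div_iff₀ (by positivity) (by norm_num)]
  nlinarith [Real.pi_pos]

lemma chebNode_pos {m j : ℕ} (hj : j ≤ m) : 0 < chebNode m j :=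
  Real.sin_pos_of_pos_of_lt_pi (chebAngle_pos m j)
    ((chebAngle_le hj).trans_lt (by linarith [Real.pi_pos]))

lemma chebNode_le_one (m j : ℕ) : chebNode m j ≤ 1 := Real.sin_le_one _

lemma chebNode_sq_lt {m i j : ℕ} (hij : i < j) (hj : j ≤ m) :
    chebNode m i ^ 2 < chebNode m j ^ 2 := by
  have h : chebNode m i < chebNode m j := by
    apply Real.sin_lt_sin_of_lt_of_le_pi_div_two
    · linarith [chebAngle_pos m i, Real.pi_pos]
    · exact chebAngle_le hj
    · have : (i : ℝ) < j := by exact_mod_cast hij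
      unfold chebAngle
      gcongr
  have := chebNode_pos (hij.le.trans hj)
  gcongr

lemma chebNode_mul_eval_cheb (m j : ℕ) :
    chebNode m j * (cheb m).eval (chebNode m j ^ 2) = (-1) ^ j := by
  unfold chebNode
  rw [sin_mul_eval_cheb]
  have : (2 * (m : ℝ) + 1) * chebAngle m j = Real.pi / 2 + j * Real.pi := by
    unfold chebAngle; field_simp; ring
  rw [this, Real.sin_add_nat_mul_pi]; simp

/-- The Lagrange coefficient at `0` of the node `j`. -/
def chebCoeff (m j : ℕ) : ℝ :=
  (Lagrange.basis (Finset.range (m + 1)) (fun i => chebNode m i ^ 2) j).eval 0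

lemma eval_zero_eq_sum_chebCoeff {m : ℕ} {p : ℝ[X]} (hp : p ∈ degreeLT ℝ (m + 1)) :
    p.eval 0 = ∑ j ∈ Finset.range (m + 1), chebCoeff m j * p.eval (chebNode m j ^ 2) := by
  have hinj : Set.InjOn (fun i => chebNode m i ^ 2) (Finset.range (m + 1) : Set ℕ) := by
    intro i hi j hj hij
    simp only [Finset.coe_range, Set.mem_Iio] at hi hj
    rcases lt_trichotomy i j with h | h | h
    · exact absurd hij (chebNode_sq_lt h (by omega)).ne
    · exact h
    · exact absurd hij (chebNode_sq_lt h (by omega)).ne'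
  have h := Lagrange.eq_interpolate hinj (f := p) (by simpa [mem_degreeLT] using hp)
  conv_lhs => rw [h]
  simp only [Lagrange.interpolate_apply, eval_finsetSum, eval_mul, eval_C, chebCoeff]
  exact Finset.sum_congr rfl fun _ _ => mul_comm _ _

/-- With `sᵢ` the squared nodes, the coefficient is the product over `i ≠ j` of `(0 - sᵢ) / (sⱼ -
sᵢ)`. The nodes are positive and increasing, so exactly the `j` factors with `i < j` are negative;
`hsign` assigns one `-1` to each of them. -/
lemma chebCoeff_alternates {m j : ℕ} (hj : j ≤ m) : 0 ≤ (-1) ^ j * chebCoeff m j := by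
  have hsign : ∏ i ∈ (Finset.range (m + 1)).erase j, (if i < j then (-1 : ℝ) else 1) = (-1) ^ j := by
    rw [Finset.prod_ite]
    have : ((Finset.range (m + 1)).erase j).filter (· < j) = Finset.range j := by
      ext i; simp; omega
    simp [this]
  rw [← hsign, chebCoeff, Lagrange.basis, eval_prod, ← Finset.prod_mul_distrib]
  refine Finset.prod_nonneg fun i hi => ?_
  simp only [Finset.mem_erase, Finset.mem_range] at hi
  simp only [Lagrange.basisDivisor, eval_mul, eval_C, eval_sub, eval_X, zero_sub]
  have hs := sq_nonneg (chebNode m i)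
  split_ifs with h
  · have := inv_nonneg.mpr (sub_nonneg.mpr (chebNode_sq_lt h hj).le)
    nlinarith [mul_nonneg this hs]
  · have h' : (chebNode m j ^ 2 - chebNode m i ^ 2)⁻¹ ≤ 0 :=
      inv_nonpos.mpr (sub_nonpos.mpr (chebNode_sq_lt (show j < i by omega) (by omega)).le)
    nlinarith [mul_nonneg_of_nonpos_of_nonpos h' (neg_nonpos.mpr hs)]

/-- The weights of the worst-case initial point. -/
def chebWeight (m j : ℕ) : ℝ := (-1) ^ j * chebCoeff m j / ((2 * m + 1) * chebNode m j)

lemma chebWeight_nonneg {m j : ℕ} (hj : j ≤ m) : 0 ≤ chebWeight m j :=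
  div_nonneg (chebCoeff_alternates hj) (mul_nonneg (by positivity) (chebNode_pos hj).le)

lemma chebCoeff_eq {m j : ℕ} (hj : j ≤ m) :
    chebCoeff m j = (-1) ^ j * (chebWeight m j * ((2 * m + 1) * chebNode m j)) := by
  have := (chebNode_pos hj).ne'
  have h2 : (2 * (m : ℝ) + 1) ≠ 0 := by positivity
  rw [chebWeight, div_mul_cancel₀ _ (mul_ne_zero h2 this), ← mul_assoc, ← mul_pow]
  simp

/-- Apply the interpolation formula at `0` to `cheb m` itself: its value there is `2m+1`, and
equioscillation at the nodes cancels the alternating signs of the coefficients. -/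
lemma sum_chebWeight (m : ℕ) : ∑ j ∈ Finset.range (m + 1), chebWeight m j = 1 := by
  have h := eval_zero_eq_sum_chebCoeff (cheb_mem_degreeLT m)
  rw [eval_cheb_zero] at h
  have h2 : (2 * (m : ℝ) + 1) ≠ 0 := by positivity
  have h3 : ∑ j ∈ Finset.range (m + 1), chebCoeff m j * (cheb m).eval (chebNode m j ^ 2) =
      (2 * m + 1) * ∑ j ∈ Finset.range (m + 1), chebWeight m j := by
    rw [Finset.mul_sum]
    refine Finset.sum_congr rfl fun j hj => ?_
    have hj : j ≤ m := by simpa [Nat.lt_succ_iff] using hj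
    rw [chebCoeff_eq hj]
    have h4 := chebNode_mul_eval_cheb m j
    have h5 : ((-1 : ℝ) ^ j) * (-1) ^ j = 1 := by rw [← mul_pow]; simp
    linear_combination (-1) ^ j * chebWeight m j * (2 * m + 1) * h4 + chebWeight m j * (2 * m + 1) * h5
  rw [h3] at h
  exact mul_left_cancel₀ h2 (by linarith)

/-- Duality: no polynomial `p` of degree at most `m` with `p 0 = 1` makes `t * p (t²)` small in mean
square over the Chebyshev nodes. -/
lemma chebyshev_mean_sq_lower_bound {m : ℕ} {p : ℝ[X]} (hp : p ∈ degreeLT ℝ (m + 1))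
    (h0 : p.eval 0 = 1) :
    1 / (2 * (m : ℝ) + 1) ^ 2 ≤ ∑ j ∈ Finset.range (m + 1),
      chebWeight m j * (chebNode m j * p.eval (chebNode m j ^ 2)) ^ 2 := by
  set f : ℕ → ℝ := fun j => chebNode m j * p.eval (chebNode m j ^ 2) with hf
  have hpos : 0 < 2 * (m : ℝ) + 1 := by positivity
  have h1 : 1 / (2 * (m : ℝ) + 1) = ∑ j ∈ Finset.range (m + 1), chebWeight m j * ((-1) ^ j * f j) := by
    rw [eval_zero_eq_sum_chebCoeff hp] at h0
    rw [div_eq_iff hpos.ne', Finset.sum_mul]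
    refine h0.symm.trans (Finset.sum_congr rfl fun j hj => ?_)
    rw [chebCoeff_eq (by simpa [Nat.lt_succ_iff] using hj)]
    simp only [hf]; ring
  -- Cauchy–Schwarz for the probability weights: the squared mean of `(-1)^j f j` is at most its
  -- mean square.
  have hcs := Finset.sum_mul_sq_le_sq_mul_sq (Finset.range (m + 1))
    (fun j => √(chebWeight m j)) (fun j => √(chebWeight m j) * ((-1) ^ j * f j))
  have e1 : ∑ j ∈ Finset.range (m + 1), √(chebWeight m j) * (√(chebWeight m j) * ((-1) ^ j * f j))
      = 1 / (2 * (m : ℝ) + 1) := by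
    rw [h1]
    refine Finset.sum_congr rfl fun j hj => ?_
    rw [← mul_assoc, Real.mul_self_sqrt (chebWeight_nonneg (by simpa [Nat.lt_succ_iff] using hj))]
  have e2 : ∑ j ∈ Finset.range (m + 1), √(chebWeight m j) ^ 2 = 1 := by
    rw [← sum_chebWeight m]
    refine Finset.sum_congr rfl fun j hj => ?_
    rw [Real.sq_sqrt (chebWeight_nonneg (by simpa [Nat.lt_succ_iff] using hj))]
  have e3 : ∑ j ∈ Finset.range (m + 1), (√(chebWeight m j) * ((-1) ^ j * f j)) ^ 2 =
      ∑ j ∈ Finset.range (m + 1), chebWeight m j * f j ^ 2 := by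
    refine Finset.sum_congr rfl fun j hj => ?_
    rw [mul_pow, Real.sq_sqrt (chebWeight_nonneg (by simpa [Nat.lt_succ_iff] using hj)), mul_pow,
      ← pow_mul, mul_comm j, pow_mul]
    simp
  rw [e1, e2, e3, one_mul, div_pow, one_pow] at hcs
  exact hcs

end

/-! ### The saddle operator of a biaffine function is affine with skew linear part. -/

section

variable {n : ℕ}

open scoped RealInnerProductSpace

lemma inner_gradient_of_affine {g : Vec n → ℝ} (hg : ∃ f : Vec n →ᵃ[ℝ] ℝ, ∀ x, g x = f x)
    (z x w : Vec n) : ⟪gradient g z, x - w⟫ = g x - g w := by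
  obtain ⟨f, hf⟩ := hg
  have hd : HasFDerivAt g f.linear.toContinuousLinearMap z := by
    have : g = fun x => f.linear.toContinuousLinearMap x + f 0 := by
      funext x
      rw [hf]
      exact congrFun f.decomp x
    rw [this]
    exact (ContinuousLinearMap.hasFDerivAt _).add_const _
  rw [gradient, hd.fderiv, InnerProductSpace.toDual_symm_apply, hf, hf]
  have := f.linearMap_vsub x w
  simpa using this

lemma inner_gradX {L : SaddleFun n} (hL : IsBiaffine L) (z : Pt n) (x w : Vec n) :
    ⟪gradX L z, x - w⟫ = L x z.snd - L w z.snd :=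
  inner_gradient_of_affine (hL.1 z.snd) _ _ _

lemma inner_gradY {L : SaddleFun n} (hL : IsBiaffine L) (z : Pt n) (y w : Vec n) :
    ⟪gradY L z, y - w⟫ = L z.fst y - L z.fst w :=
  inner_gradient_of_affine (hL.2 z.fst) _ _ _

/-- An affine function with an extremum is constant: compare each point with its reflection through
the saddle point. -/
lemma eq_of_isSaddlePoint {L : SaddleFun n} (hL : IsBiaffine L) {zs : Pt n}
    (hs : IsSaddlePoint L zs) (x y : Vec n) :
    L x zs.snd = L zs.fst zs.snd ∧ L zs.fst y = L zs.fst zs.snd := by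
  have hx := inner_gradX hL zs x zs.fst
  have hx' := inner_gradX hL zs (zs.fst - (x - zs.fst)) zs.fst
  have hy := inner_gradY hL zs y zs.snd
  have hy' := inner_gradY hL zs (zs.snd - (y - zs.snd)) zs.snd
  rw [sub_sub_cancel_left, inner_neg_right] at hx' hy'
  have h1 := (hs x y)
  have h2 := (hs (zs.fst - (x - zs.fst)) (zs.snd - (y - zs.snd)))
  constructor <;> linarith [h1.1, h1.2, h2.1, h2.2]

/-- The two remaining values of `L` lie on the slices through `zs`, where `L` is constant, and
cancel. The resulting expression is antisymmetric in `u` and `v`, which yields skewness. -/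
lemma inner_saddleOp {L : SaddleFun n} (hL : IsBiaffine L) {zs : Pt n}
    (hs : IsSaddlePoint L zs) (u v : Pt n) :
    ⟪saddleOp L (zs + u), v⟫ =
      L (zs.fst + v.fst) (zs.snd + u.snd) - L (zs.fst + u.fst) (zs.snd + v.snd) := by
  have hx := inner_gradX hL (zs + u) (zs.fst + v.fst) zs.fst
  have hy := inner_gradY hL (zs + u) (zs.snd + v.snd) zs.snd
  rw [add_sub_cancel_left] at hx hy
  simp only [saddleOp, WithLp.prod_inner_apply, inner_neg_left, WithLp.add_fst, WithLp.add_snd]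
    at hx hy ⊢
  have e1 := (eq_of_isSaddlePoint hL hs (zs.fst + u.fst) (zs.snd + u.snd))
  change ⟪gradX L (zs + u), v.fst⟫ + -⟪gradY L (zs + u), v.snd⟫ = _
  linarith [e1.1, e1.2]

/-- The saddle operator of a biaffine function, recentred at a saddle point, is linear. -/
def linearSaddleOp {L : SaddleFun n} (hL : IsBiaffine L) {zs : Pt n} (hs : IsSaddlePoint L zs) :
    Pt n →ₗ[ℝ] Pt n where
  toFun u := saddleOp L (zs + u)
  map_add' u v := by
    -- Skewness alone forces linearity: the argument moves to the linear slot of the inner product.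
    have h : ∀ a b : Pt n, ⟪saddleOp L (zs + a), b⟫ = -⟪a, saddleOp L (zs + b)⟫ := fun a b => by
      rw [real_inner_comm _ a, inner_saddleOp hL hs, inner_saddleOp hL hs]; ring
    refine ext_inner_right ℝ fun w => ?_
    simp only [inner_add_left, h]; ring
  map_smul' c u := by
    have h : ∀ a b : Pt n, ⟪saddleOp L (zs + a), b⟫ = -⟪a, saddleOp L (zs + b)⟫ := fun a b => by
      rw [real_inner_comm _ a, inner_saddleOp hL hs, inner_saddleOp hL hs]; ring
    refine ext_inner_right ℝ fun w => ?_
    simp only [real_inner_smul_left, h, RingHom.id_apply]; ring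

lemma linearSaddleOp_apply {L : SaddleFun n} (hL : IsBiaffine L) {zs : Pt n}
    (hs : IsSaddlePoint L zs) (u : Pt n) : linearSaddleOp hL hs u = saddleOp L (zs + u) := rfl

lemma saddleOp_eq_linearSaddleOp {L : SaddleFun n} (hL : IsBiaffine L) {zs : Pt n}
    (hs : IsSaddlePoint L zs) (z : Pt n) : saddleOp L z = linearSaddleOp hL hs (z - zs) := by
  rw [linearSaddleOp_apply, add_sub_cancel]

lemma linearSaddleOp_skew {L : SaddleFun n} (hL : IsBiaffine L) {zs : Pt n}
    (hs : IsSaddlePoint L zs) (u v : Pt n) :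
    ⟪linearSaddleOp hL hs u, v⟫ = -⟪u, linearSaddleOp hL hs v⟫ := by
  rw [real_inner_comm _ u, linearSaddleOp_apply, linearSaddleOp_apply, inner_saddleOp hL hs,
    inner_saddleOp hL hs]
  ring

lemma norm_linearSaddleOp_le {R : ℝ} {L : SaddleFun n} (hL : IsBiaffine L) (hR : IsSmooth R L)
    {zs : Pt n} (hs : IsSaddlePoint L zs) (u : Pt n) :
    ‖linearSaddleOp hL hs u‖ ≤ R * ‖u‖ := by
  have h := hR.2 (zs + u) (zs + 0)
  rw [← linearSaddleOp_apply hL hs, ← linearSaddleOp_apply hL hs, map_zero, sub_zero] at h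
  simpa using h

lemma norm_grad (L : SaddleFun n) (z : Pt n) : ‖grad L z‖ = ‖saddleOp L z‖ := by
  rw [← sq_eq_sq₀ (norm_nonneg _) (norm_nonneg _), grad, saddleOp]
  simp [WithLp.prod_norm_sq_eq_of_L2]

lemma isConvexConcave_of_isBiaffine {L : SaddleFun n} (hL : IsBiaffine L) : IsConvexConcave L := by
  constructor
  · intro y
    obtain ⟨f, hf⟩ := hL.1 y
    rw [funext hf]
    have := (convexOn_id (𝕜 := ℝ) (β := ℝ) convex_univ).comp_affineMap f
    simpa using this
  · intro x
    obtain ⟨f, hf⟩ := hL.2 x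
    rw [show L x = f from funext hf]
    have := (concaveOn_id (𝕜 := ℝ) (β := ℝ) convex_univ).comp_affineMap f
    simpa using this

end

/-! ### The Chebyshev method and the upper bound. -/

section

variable {n : ℕ}

open scoped RealInnerProductSpace

/-- A Chebyshev iteration in the square of the saddle operator: one step of the three-term recurrence
takes two gradient evaluations, and the iteration stops after `N` evaluations. -/
def chebAlg (n : ℕ) (R : ℝ) (N : ℕ) : Algorithm n := fun L j h =>
  if N ≤ j then h (Fin.last j)
  else if Even j then h (Fin.last j) - saddleOp L (h (Fin.last j))
  -- The weights `2j` and `-(j - 2)` sum to `j + 2`, so errors obey the same recurrence as iterates.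
  -- At `j = 1` the index `j - 3` truncates to `0` and the weight `-(j - 2)` is `+1`; this encodes
  -- `cheb (-1) = -1`.
  else ((j : ℝ) + 2)⁻¹ • ((2 * (j : ℝ)) • (h ⟨j - 1, by omega⟩ +
      (2 / R ^ 2) • (saddleOp L (h ⟨j - 1, by omega⟩) - saddleOp L (h (Fin.last j)))) -
      ((j : ℝ) - 2) • h ⟨j - 3, by omega⟩)

lemma iterate_chebAlg_of_le (R : ℝ) {N j : ℕ} (L : SaddleFun n) (z0 : Pt n) (h : N ≤ j) :
    iterate (chebAlg n R N) L z0 (j + 1) = iterate (chebAlg n R N) L z0 j := by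
  rw [iterate, chebAlg, if_pos h]; rfl

lemma iterate_chebAlg_of_even (R : ℝ) {N j : ℕ} (L : SaddleFun n) (z0 : Pt n) (h : j < N)
    (hj : Even j) : iterate (chebAlg n R N) L z0 (j + 1) =
      iterate (chebAlg n R N) L z0 j - saddleOp L (iterate (chebAlg n R N) L z0 j) := by
  rw [iterate, chebAlg, if_neg h.not_ge, if_pos hj]; rfl

lemma iterate_chebAlg_of_not_even (R : ℝ) {N j : ℕ} (L : SaddleFun n) (z0 : Pt n) (h : j < N)
    (hj : ¬ Even j) : iterate (chebAlg n R N) L z0 (j + 1) =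
      ((j : ℝ) + 2)⁻¹ • ((2 * (j : ℝ)) • (iterate (chebAlg n R N) L z0 (j - 1) +
      (2 / R ^ 2) • (saddleOp L (iterate (chebAlg n R N) L z0 (j - 1)) -
        saddleOp L (iterate (chebAlg n R N) L z0 j))) -
      ((j : ℝ) - 2) • iterate (chebAlg n R N) L z0 (j - 3)) := by
  rw [iterate, chebAlg, if_neg h.not_ge, if_neg hj]; rfl

/-- Every update is an affine combination of earlier iterates plus gradients. The projection `π`
lets one induction serve both the `x` and the `y` block. -/
lemma map_iterate_chebAlg_sub_mem (R : ℝ) (N : ℕ) (L : SaddleFun n) (z0 : Pt n)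
    (π : Pt n →ₗ[ℝ] Vec n) (V : ℕ → Submodule ℝ (Vec n)) (hV : Monotone V)
    (hG : ∀ j, π (saddleOp L (iterate (chebAlg n R N) L z0 j)) ∈ V (j + 1)) (j : ℕ) :
    π (iterate (chebAlg n R N) L z0 j) - π z0 ∈ V j := by
  induction j using Nat.strong_induction_on with
  | _ j ih =>
    rcases j with _ | j
    · rw [iterate, sub_self]; exact zero_mem _
    · have hprev : ∀ i ≤ j, π (iterate (chebAlg n R N) L z0 i) - π z0 ∈ V (j + 1) :=
        fun i hi => hV (by omega) (ih i (by omega))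
      have hgrad : ∀ i ≤ j, π (saddleOp L (iterate (chebAlg n R N) L z0 i)) ∈ V (j + 1) :=
        fun i hi => hV (by omega) (hG i)
      by_cases hN : N ≤ j
      · rw [iterate_chebAlg_of_le R L z0 hN]
        exact hprev j le_rfl
      · by_cases hj : Even j
        · rw [iterate_chebAlg_of_even R L z0 (by omega) hj, map_sub, sub_right_comm]
          exact sub_mem (hprev j le_rfl) (hgrad j le_rfl)
        · rw [iterate_chebAlg_of_not_even R L z0 (by omega) hj]
          simp only [map_sub, map_smul, map_add]
          generalize hg : 2 / R ^ 2 = c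
          have h2 : ((j : ℝ) + 2) ≠ 0 := by positivity
          have key : ∀ a b d g g' : Vec n, ((j : ℝ) + 2)⁻¹ • ((2 * (j : ℝ)) • (a +
              c • (g - g')) - ((j : ℝ) - 2) • b) - d =
              ((j : ℝ) + 2)⁻¹ • ((2 * (j : ℝ)) • ((a - d) +
              c • (g - g')) - ((j : ℝ) - 2) • (b - d)) := by
            intro a b d g g'
            have : d = ((j : ℝ) + 2)⁻¹ • (((j : ℝ) + 2) • d) := by rw [inv_smul_smul₀ h2]
            conv_lhs => rw [this]
            rw [← smul_sub]
            congr 1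
            module
          rw [key]
          exact (V (j + 1)).smul_mem _ (sub_mem ((V (j + 1)).smul_mem _ (add_mem (hprev _ (by omega))
            ((V (j + 1)).smul_mem _ (sub_mem (hgrad _ (by omega)) (hgrad _ le_rfl)))))
            ((V (j + 1)).smul_mem _ (hprev _ (by omega))))

lemma chebAlg_mem_algSep (n : ℕ) (R : ℝ) (N : ℕ) : chebAlg n R N ∈ algSep n := by
  intro L _ _ z0 j
  constructor
  · refine map_iterate_chebAlg_sub_mem R N L z0 (WithLp.fstₗ 2 ℝ (Vec n) (Vec n)) (fun j =>
      Submodule.span ℝ ((fun i => gradX L (iterate (chebAlg n R N) L z0 i)) '' Set.Iio j))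
      (fun a b hab => Submodule.span_mono (Set.image_mono (Set.Iio_subset_Iio hab))) (fun i => ?_) j
    exact Submodule.subset_span ⟨i, by simp, rfl⟩
  · refine map_iterate_chebAlg_sub_mem R N L z0 (WithLp.sndₗ 2 ℝ (Vec n) (Vec n)) (fun j =>
      Submodule.span ℝ ((fun i => gradY L (iterate (chebAlg n R N) L z0 i)) '' Set.Iio j))
      (fun a b hab => Submodule.span_mono (Set.image_mono (Set.Iio_subset_Iio hab))) (fun i => ?_) j
    exact Submodule.neg_mem _ (Submodule.subset_span ⟨i, by simp, rfl⟩)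

lemma chebAlg_mem_algGradientBased (n : ℕ) (R : ℝ) (N : ℕ) :
    chebAlg n R N ∈ algGradientBased n := by
  intro L L' j h hg
  have : ∀ i, saddleOp L (h i) = saddleOp L' (h i) := fun i => by
    rw [saddleOp, saddleOp, (hg i).1, (hg i).2]
  simp only [chebAlg, this]

section Upper

variable {R : ℝ} {L : SaddleFun n} {zs : Pt n}

/-- The square `-G²` of the modulus of the recentred saddle operator `G`. -/
def saddleSq (hL : IsBiaffine L) (hs : IsSaddlePoint L zs) : Pt n →ₗ[ℝ] Pt n :=
  -(linearSaddleOp hL hs ∘ₗ linearSaddleOp hL hs)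

lemma inner_saddleSq (hL : IsBiaffine L) (hs : IsSaddlePoint L zs) (u v : Pt n) :
    ⟪saddleSq hL hs u, v⟫ = ⟪linearSaddleOp hL hs u, linearSaddleOp hL hs v⟫ := by
  simp only [saddleSq, LinearMap.neg_apply, LinearMap.comp_apply, inner_neg_left]
  rw [linearSaddleOp_skew, neg_neg]

lemma saddleSq_isSymmetric (hL : IsBiaffine L) (hs : IsSaddlePoint L zs) :
    (saddleSq hL hs).IsSymmetric := fun u v => by
  rw [inner_saddleSq, real_inner_comm _ u, inner_saddleSq, real_inner_comm]

/-- Tested against an eigenvector of `-G²`, the iteration becomes the scalar recurrence of `cheb`;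
the factor `2i + 1` is `cheb i` at `0`. -/
lemma inner_iterate_chebAlg (hR : 0 < R) (hL : IsBiaffine L) (hs : IsSaddlePoint L zs) (z0 : Pt n)
    {e : Pt n} {μ : ℝ} (he : saddleSq hL hs e = μ • e) (N i : ℕ) (hi : 2 * i ≤ N) :
    (2 * (i : ℝ) + 1) * ⟪e, iterate (chebAlg n R N) L z0 (2 * i) - zs⟫ =
      (cheb i).eval (μ / R ^ 2) * ⟪e, z0 - zs⟫ := by
  have step : ∀ i, 2 * i + 2 ≤ N →
      (2 * (i : ℝ) + 3) * ⟪e, iterate (chebAlg n R N) L z0 (2 * i + 2) - zs⟫ =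
        2 * (1 - 2 * (μ / R ^ 2)) * ((2 * (i : ℝ) + 1) *
          ⟪e, iterate (chebAlg n R N) L z0 (2 * i) - zs⟫) -
        (2 * (i : ℝ) - 1) * ⟪e, iterate (chebAlg n R N) L z0 (2 * i - 2) - zs⟫ := by
    intro i hi
    rw [iterate_chebAlg_of_not_even R L z0 (j := 2 * i + 1) (by omega) (by simp)]
    rw [show 2 * i + 1 - 1 = 2 * i by omega, show 2 * i + 1 - 3 = 2 * i - 2 by omega]
    -- The odd iterate is only a probe `z - G z`: its gradient difference to `z` gives `G²` applied
    -- to the error without knowing `zs`.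
    have hdiff : saddleOp L (iterate (chebAlg n R N) L z0 (2 * i)) -
        saddleOp L (iterate (chebAlg n R N) L z0 (2 * i + 1)) =
        - saddleSq hL hs (iterate (chebAlg n R N) L z0 (2 * i) - zs) := by
      rw [iterate_chebAlg_of_even R L z0 (by omega) (by simp)]
      simp only [saddleOp_eq_linearSaddleOp hL hs, ← map_sub, saddleSq, LinearMap.neg_apply,
        LinearMap.comp_apply, neg_neg]
      congr 1
      abel
    have hμ : ∀ w, ⟪e, saddleSq hL hs w⟫ = μ * ⟪e, w⟫ := fun w => by
      rw [← saddleSq_isSymmetric, he, real_inner_smul_left]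
    rw [hdiff]
    simp only [inner_sub_right, inner_add_right, real_inner_smul_right, inner_neg_right, hμ]
    push_cast
    have : (2 * (i : ℝ) + 1 + 2) ≠ 0 := by positivity
    field_simp
    ring
  induction i using Nat.twoStepInduction with
  | zero => simp [cheb, iterate]
  | one =>
    have h := step 0 hi
    have h0 : iterate (chebAlg n R N) L z0 0 = z0 := by rw [iterate]
    simp only [Nat.zero_sub, h0, CharP.cast_eq_zero, mul_zero,
      zero_add, zero_sub] at h
    simp only [cheb, Polynomial.eval_sub, Polynomial.eval_mul, Polynomial.eval_X,
      Polynomial.eval_ofNat]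
    push_cast
    rw [mul_one]
    linear_combination h
  | more i ih₁ ih₂ =>
    have h := step (i + 1) (by omega)
    rw [show 2 * (i + 1) - 2 = 2 * i by omega, ih₂ (by omega)] at h
    have h1 := ih₁ (by omega)
    simp only [cheb, Polynomial.eval_sub, Polynomial.eval_mul, Polynomial.eval_X,
      Polynomial.eval_ofNat, Polynomial.eval_one]
    push_cast at h ⊢
    rw [show 2 * (i + 2) = 2 * (i + 1) + 2 by ring]
    linear_combination h - h1

/-- Expand `‖G w‖² = ⟪S w, w⟫` in an eigenbasis of `S = -G²` and bound each term by `s * cheb m (s)²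
≤ 1` at `s = μ / R² ∈ [0, 1]`. -/
lemma norm_grad_iterate_chebAlg_sq_le (hR : 0 < R) (hL : IsBiaffine L) (hS : IsSmooth R L)
    (hs : IsSaddlePoint L zs) (z0 : Pt n) (m : ℕ) :
    ‖grad L (iterate (chebAlg n R (2 * m)) L z0 (2 * m))‖ ^ 2 ≤
      R ^ 2 * ‖z0 - zs‖ ^ 2 / (2 * (m : ℝ) + 1) ^ 2 := by
  set w := iterate (chebAlg n R (2 * m)) L z0 (2 * m) - zs with hw
  have hsym := saddleSq_isSymmetric hL hs
  set b := hsym.eigenvectorBasis rfl with hb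
  set μ := hsym.eigenvalues rfl with hμ
  have hbe : ∀ a, saddleSq hL hs (b a) = μ a • b a := fun a => by
    exact hsym.apply_eigenvectorBasis rfl a
  have hμ_eq : ∀ a, μ a = ‖linearSaddleOp hL hs (b a)‖ ^ 2 := fun a => by
    rw [← real_inner_self_eq_norm_sq, ← inner_saddleSq, hbe, real_inner_smul_left,
      real_inner_self_eq_norm_sq, b.norm_eq_one]
    ring
  have hμ1 : ∀ a, μ a / R ^ 2 ≤ 1 := fun a => by
    rw [div_le_one (by positivity), hμ_eq]
    have := norm_linearSaddleOp_le hL hS hs (b a)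
    rw [b.norm_eq_one, mul_one] at this
    gcongr
  have hpos : 0 < 2 * (m : ℝ) + 1 := by positivity
  rw [norm_grad, saddleOp_eq_linearSaddleOp hL hs, ← hw, ← real_inner_self_eq_norm_sq,
    ← inner_saddleSq, ← b.sum_inner_mul_inner, ← b.sum_sq_inner_right (z0 - zs), Finset.mul_sum,
    Finset.sum_div]
  refine Finset.sum_le_sum fun a _ => ?_
  have hc := inner_iterate_chebAlg hR hL hs z0 (hbe a) (2 * m) m le_rfl
  rw [← hw] at hc
  rw [hsym, hbe, real_inner_smul_right, real_inner_comm, le_div_iff₀ (by positivity)]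
  have hq := mul_eval_cheb_sq_le m (div_nonneg (hμ_eq a ▸ sq_nonneg _) (sq_nonneg R)) (hμ1 a)
  calc _ = μ a * ((2 * (m : ℝ) + 1) * ⟪b a, w⟫) ^ 2 := by ring
    _ = R ^ 2 * ⟪b a, z0 - zs⟫ ^ 2 * (μ a / R ^ 2 * (cheb m).eval (μ a / R ^ 2) ^ 2) := by
      rw [hc]; field_simp
    _ ≤ R ^ 2 * ⟪b a, z0 - zs⟫ ^ 2 * 1 := by gcongr
    _ = _ := mul_one _

end Upper

lemma optimalComplexity_le (n k : ℕ) {R D : ℝ} (hR : 0 < R) :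
    optimalComplexity (algSep n ∩ algGradientBased n) (smoothBiaffine n R) D k ≤
      ENNReal.ofReal (R ^ 2 * D ^ 2 / (2 * ((k / 2 : ℕ) : ℝ) + 1) ^ 2) := by
  refine iInf₂_le_of_le (chebAlg n R (2 * (k / 2)))
    ⟨chebAlg_mem_algSep _ _ _, chebAlg_mem_algGradientBased _ _ _⟩ ?_
  refine iSup₂_le fun L hL => iSup₂_le fun z0 ⟨zs, hs, hD⟩ => ENNReal.ofReal_le_ofReal ?_
  -- For odd `k` the last step would be a mere probe; stopping after `2 * (k / 2)` evaluations keeps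
  -- the last useful iterate.
  have hk : iterate (chebAlg n R (2 * (k / 2))) L z0 k =
      iterate (chebAlg n R (2 * (k / 2))) L z0 (2 * (k / 2)) := by
    rcases Nat.even_or_odd' k with ⟨m, rfl | rfl⟩
    · rw [show 2 * m / 2 = m by omega]
    · rw [show (2 * m + 1) / 2 = m by omega, iterate_chebAlg_of_le R L z0 le_rfl]
  rw [hk]
  refine (norm_grad_iterate_chebAlg_sq_le hR hL.1 hL.2 hs z0 _).trans ?_
  gcongr

end

/-! ### The hard diagonal instance and the lower bound. -/

section

variable {n : ℕ}

open scoped RealInnerProductSpace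
open Polynomial

lemma norm_toLp_sq (a b : Vec n) : ‖(WithLp.toLp 2 (a, b) : Pt n)‖ ^ 2 = ‖a‖ ^ 2 + ‖b‖ ^ 2 :=
  WithLp.prod_norm_sq_eq_of_L2 _

lemma sub_toLp_sub (z : Pt n) (u : Vec n) :
    z - WithLp.toLp 2 (z.fst - u, z.snd) = WithLp.toLp 2 (u, 0) :=
  WithLp.ofLp_injective 2 (Prod.ext (sub_sub_cancel _ _) (sub_self _))

/-- The diagonal operator with entries `τ`. -/
def diagOp (τ : Fin n → ℝ) : Vec n →ₗ[ℝ] Vec n where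
  toFun v := WithLp.toLp 2 fun i => τ i * v i
  map_add' u v := by ext i; simp [mul_add]
  map_smul' c v := by ext i; simp; ring

@[simp] lemma diagOp_apply (τ : Fin n → ℝ) (v : Vec n) (i : Fin n) : diagOp τ v i = τ i * v i := rfl

lemma inner_diagOp (τ : Fin n → ℝ) (u v : Vec n) : ⟪diagOp τ u, v⟫ = ⟪diagOp τ v, u⟫ := by
  simp only [PiLp.inner_apply, diagOp_apply, RCLike.inner_apply, conj_trivial]
  exact Finset.sum_congr rfl fun i _ => by ring

lemma norm_diagOp_sq_le {τ : Fin n → ℝ} (h0 : ∀ i, 0 ≤ τ i) (h1 : ∀ i, τ i ≤ 1) (v : Vec n) :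
    ‖diagOp τ v‖ ^ 2 ≤ ‖v‖ ^ 2 := by
  rw [EuclideanSpace.real_norm_sq_eq, EuclideanSpace.real_norm_sq_eq]
  refine Finset.sum_le_sum fun i _ => ?_
  rw [diagOp_apply, mul_pow]
  exact mul_le_of_le_one_left (sq_nonneg _) (pow_le_one₀ (h0 i) (h1 i))

/-- The bilinear saddle function with coupling `R • diag τ` centred at `zs`. -/
def diagSaddle (R : ℝ) (τ : Fin n → ℝ) (zs : Pt n) : SaddleFun n :=
  fun x y => R * ⟪diagOp τ (x - zs.fst), y - zs.snd⟫

lemma isBiaffine_diagSaddle (R : ℝ) (τ : Fin n → ℝ) (zs : Pt n) :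
    IsBiaffine (diagSaddle R τ zs) := by
  constructor
  · intro y
    set l : Vec n →ₗ[ℝ] ℝ := R • (innerₗ (Vec n) (y - zs.snd) ∘ₗ diagOp τ)
    refine ⟨l.toAffineMap - AffineMap.const ℝ _ (l zs.fst), fun x => ?_⟩
    change _ = l x - l zs.fst
    rw [← map_sub]
    exact congrArg (R * ·) (real_inner_comm _ _)
  · intro x
    set l : Vec n →ₗ[ℝ] ℝ := R • innerₗ (Vec n) (diagOp τ (x - zs.fst))
    refine ⟨l.toAffineMap - AffineMap.const ℝ _ (l zs.snd), fun y => ?_⟩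
    change _ = l y - l zs.snd
    rw [← map_sub]
    rfl

lemma gradX_diagSaddle (R : ℝ) (τ : Fin n → ℝ) (zs z : Pt n) :
    gradX (diagSaddle R τ zs) z = R • diagOp τ (z.snd - zs.snd) := by
  refine ext_inner_right ℝ fun v => ?_
  have h := inner_gradX (isBiaffine_diagSaddle R τ zs) z (zs.fst + v) zs.fst
  rw [add_sub_cancel_left] at h
  rw [h, real_inner_smul_left, inner_diagOp]
  simp [diagSaddle]

lemma gradY_diagSaddle (R : ℝ) (τ : Fin n → ℝ) (zs z : Pt n) :
    gradY (diagSaddle R τ zs) z = R • diagOp τ (z.fst - zs.fst) := by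
  refine ext_inner_right ℝ fun v => ?_
  have h := inner_gradY (isBiaffine_diagSaddle R τ zs) z (zs.snd + v) zs.snd
  rw [add_sub_cancel_left] at h
  rw [h, real_inner_smul_left]
  simp [diagSaddle]

lemma isSmooth_diagSaddle {R : ℝ} (hR : 0 ≤ R) {τ : Fin n → ℝ} (h0 : ∀ i, 0 ≤ τ i)
    (h1 : ∀ i, τ i ≤ 1) (zs : Pt n) : IsSmooth R (diagSaddle R τ zs) := by
  constructor
  · exact (((diagOp τ).toContinuousLinearMap.differentiable.comp
      (differentiable_fst.sub_const zs.fst)).inner ℝ (differentiable_snd.sub_const zs.snd)).const_mul R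
  · intro z w
    refine le_of_sq_le_sq ?_ (by positivity)
    have hd : saddleOp (diagSaddle R τ zs) z - saddleOp (diagSaddle R τ zs) w =
        WithLp.toLp 2 (R • diagOp τ (z.snd - w.snd), -(R • diagOp τ (z.fst - w.fst))) := by
      simp only [saddleOp, gradX_diagSaddle, gradY_diagSaddle, ← WithLp.toLp_sub, Prod.mk_sub_mk]
      simp only [map_sub, smul_sub]
      congr 2 <;> abel
    rw [hd, mul_pow, norm_toLp_sq, WithLp.prod_norm_sq_eq_of_L2]
    simp only [norm_neg, norm_smul, mul_pow, Real.norm_eq_abs, sq_abs, WithLp.sub_fst,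
      WithLp.sub_snd]
    nlinarith [norm_diagOp_sq_le h0 h1 (z.snd - w.snd), norm_diagOp_sq_le h0 h1 (z.fst - w.fst),
      sq_nonneg R]

lemma isSaddlePoint_diagSaddle (R : ℝ) (τ : Fin n → ℝ) (zs : Pt n) :
    IsSaddlePoint (diagSaddle R τ zs) zs := by
  intro x y
  simp [diagSaddle]

lemma diagOp_eq_zero_of_isSaddlePoint {R : ℝ} (hR : 0 < R) {τ : Fin n → ℝ} {zs w : Pt n}
    (hw : IsSaddlePoint (diagSaddle R τ zs) w) : diagOp τ (w.fst - zs.fst) = 0 := by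
  have h := fun y => (eq_of_isSaddlePoint (isBiaffine_diagSaddle R τ zs) hw w.fst y).2
  refine ext_inner_right ℝ fun v => ?_
  have h1 := (h (zs.snd + v)).trans (h zs.snd).symm
  simpa [diagSaddle, hR.ne'] using h1

/-- All saddle points share the `x`-coordinates with `τ i ≠ 0`. In the others the chosen centre
agrees with `z0` because `u i = 0`, as it does in all of `y`. -/
lemma isClosestSaddlePoint_diagSaddle {R : ℝ} (hR : 0 < R) {τ : Fin n → ℝ} {z0 : Pt n} {u : Vec n}
    (hu : ∀ i, τ i = 0 → u i = 0) :
    IsClosestSaddlePoint (diagSaddle R τ (WithLp.toLp 2 (z0.fst - u, z0.snd))) z0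
      (WithLp.toLp 2 (z0.fst - u, z0.snd)) := by
  refine ⟨isSaddlePoint_diagSaddle _ _ _, fun w hw => ?_⟩
  have h := diagOp_eq_zero_of_isSaddlePoint hR hw
  refine le_of_sq_le_sq ?_ (norm_nonneg _)
  rw [sub_toLp_sub, norm_toLp_sq, WithLp.prod_norm_sq_eq_of_L2, norm_zero, zero_pow two_ne_zero,
    add_zero]
  simp only [WithLp.sub_fst, WithLp.sub_snd]
  rw [EuclideanSpace.real_norm_sq_eq u, EuclideanSpace.real_norm_sq_eq (z0.fst - w.fst)]
  have : ∑ i, u i ^ 2 ≤ ∑ i, (z0.fst - w.fst) i ^ 2 := by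
    refine Finset.sum_le_sum fun i _ => ?_
    have hi : τ i * (w.fst i - (z0.fst i - u i)) = 0 := congrArg (fun v : Vec n => v i) h
    rcases mul_eq_zero.mp hi with h | h
    · rw [hu i h]; simpa using sq_nonneg _
    · refine le_of_eq ?_
      have : u i = (z0.fst - w.fst) i := by
        rw [PiLp.sub_apply]; linarith
      rw [this]
  have h2 := sq_nonneg ‖z0.snd - w.snd‖
  exact this.trans (le_add_of_nonneg_right h2)

/-- `p ↦ p(T²) u` for the diagonal operator `T` with entries `τ`. -/
def diagAeval (τ : Fin n → ℝ) (u : Vec n) : ℝ[X] →ₗ[ℝ] Vec n where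
  toFun p := WithLp.toLp 2 fun i => p.eval (τ i ^ 2) * u i
  map_add' p q := by ext i; simp [add_mul]
  map_smul' c p := by ext i; simp [mul_assoc]

@[simp] lemma diagAeval_apply (τ : Fin n → ℝ) (u : Vec n) (p : ℝ[X]) (i : Fin n) :
    diagAeval τ u p i = p.eval (τ i ^ 2) * u i := rfl

lemma diagAeval_one_add_X_mul (τ : Fin n → ℝ) (u : Vec n) (p : ℝ[X]) :
    diagAeval τ u (1 + X * p) = u + diagOp τ (diagOp τ (diagAeval τ u p)) := by
  ext i
  simp
  ring

/-- Started with a vanishing `y`-error, a method of `algSep` stays in the Krylov spaces of `T`. -/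
lemma exists_diagAeval_of_mem_algSep {A : Algorithm n} (hA : A ∈ algSep n) {R : ℝ} {τ : Fin n → ℝ}
    {z0 : Pt n} {u : Vec n}
    (hS : IsSmooth R (diagSaddle R τ (WithLp.toLp 2 (z0.fst - u, z0.snd)))) (j : ℕ) :
    (∃ p ∈ degreeLT ℝ (j / 2),
      (iterate A (diagSaddle R τ (WithLp.toLp 2 (z0.fst - u, z0.snd))) z0 j).fst - z0.fst =
        diagOp τ (diagOp τ (diagAeval τ u p))) ∧
    ∃ q ∈ degreeLT ℝ ((j + 1) / 2),
      (iterate A (diagSaddle R τ (WithLp.toLp 2 (z0.fst - u, z0.snd))) z0 j).snd - z0.snd =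
        diagOp τ (diagAeval τ u q) := by
  set zs : Pt n := WithLp.toLp 2 (z0.fst - u, z0.snd) with hzs
  set L := diagSaddle R τ zs with hL
  induction j using Nat.strong_induction_on with
  | _ j ih =>
    have h := hA L (isConvexConcave_of_isBiaffine (isBiaffine_diagSaddle R τ zs)) ⟨R, hS⟩ z0 j
    -- `∇ₓ` sees only the `y`-displacement and `∇_y` only the `x`-error, each through one factor
    -- `T`. Hence the degree grows in one block at a time, giving `j / 2` for `x` and `(j + 1) / 2`
    -- for `y`; in particular `x` cannot move in the first step.
    have hx : Submodule.span ℝ ((fun i => gradX L (iterate A L z0 i)) '' Set.Iio j) ≤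
        (degreeLT ℝ (j / 2)).map (diagOp τ ∘ₗ diagOp τ ∘ₗ diagAeval τ u) := by
      rw [Submodule.span_le]
      rintro _ ⟨i, hi, rfl⟩
      obtain ⟨q, hq, hqe⟩ := (ih i hi).2
      refine ⟨R • q, Submodule.smul_mem _ _ (degreeLT_mono (by have := Set.mem_Iio.mp hi; omega) hq), ?_⟩
      change _ = gradX L (iterate A L z0 i)
      rw [hL, gradX_diagSaddle]
      change _ = R • diagOp τ ((iterate A L z0 i).snd - z0.snd)
      rw [hqe]
      simp
    have hy : Submodule.span ℝ ((fun i => gradY L (iterate A L z0 i)) '' Set.Iio j) ≤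
        (degreeLT ℝ ((j + 1) / 2)).map (diagOp τ ∘ₗ diagAeval τ u) := by
      rw [Submodule.span_le]
      rintro _ ⟨i, hi, rfl⟩
      obtain ⟨p, hp, hpe⟩ := (ih i hi).1
      have hi := Set.mem_Iio.mp hi
      refine ⟨R • (1 + X * p), Submodule.smul_mem _ _ (degreeLT_mono (show i / 2 + 1 ≤ _ by omega)
        (add_mem (one_mem_degreeLT _) (X_mul_mem_degreeLT hp))), ?_⟩
      change _ = gradY L (iterate A L z0 i)
      rw [hL, gradY_diagSaddle]
      change _ = R • diagOp τ ((iterate A L z0 i).fst - (z0.fst - u))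
      rw [LinearMap.comp_apply, map_smul, map_smul, diagAeval_one_add_X_mul, ← hpe]
      congr 2
      abel
    obtain ⟨p, hp, hpe⟩ := hx h.1
    obtain ⟨q, hq, hqe⟩ := hy h.2
    exact ⟨⟨p, hp, hpe.symm⟩, ⟨q, hq, hqe.symm⟩⟩

/-- The `x`-error is `u` plus a displacement in the range of `T²`, hence `p (T²) u` with `p 0 = 1`.
Only `∇_y` is kept, which equals `R T p (T²) u`. -/
lemma exists_poly_le_norm_grad_sq {A : Algorithm n} (hA : A ∈ algSep n) {R : ℝ} {τ : Fin n → ℝ}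
    {z0 : Pt n} {u : Vec n}
    (hS : IsSmooth R (diagSaddle R τ (WithLp.toLp 2 (z0.fst - u, z0.snd)))) (k : ℕ) :
    ∃ p ∈ degreeLT ℝ (k / 2 + 1), p.eval 0 = 1 ∧
      R ^ 2 * ∑ i, u i ^ 2 * (τ i * p.eval (τ i ^ 2)) ^ 2 ≤
        ‖grad (diagSaddle R τ (WithLp.toLp 2 (z0.fst - u, z0.snd)))
          (iterate A (diagSaddle R τ (WithLp.toLp 2 (z0.fst - u, z0.snd))) z0 k)‖ ^ 2 := by
  obtain ⟨⟨p, hp, hpe⟩, -⟩ := exists_diagAeval_of_mem_algSep hA hS k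
  refine ⟨1 + X * p, add_mem (one_mem_degreeLT _) (X_mul_mem_degreeLT hp), by simp, ?_⟩
  generalize iterate A _ z0 k = z at hpe ⊢
  rw [WithLp.prod_norm_sq_eq_of_L2]
  refine le_add_of_nonneg_of_le (sq_nonneg _) (le_of_eq ?_)
  change _ = ‖gradY _ z‖ ^ 2
  rw [gradY_diagSaddle]
  change _ = ‖R • diagOp τ (z.fst - (z0.fst - u))‖ ^ 2
  have : z.fst - (z0.fst - u) = diagAeval τ u (1 + X * p) := by
    rw [diagAeval_one_add_X_mul, ← hpe]; abel
  rw [this, norm_smul, mul_pow, Real.norm_eq_abs, sq_abs, EuclideanSpace.real_norm_sq_eq]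
  congr 1
  refine Finset.sum_congr rfl fun i _ => ?_
  rw [diagOp_apply, diagAeval_apply]
  ring

/-- Extension by zero of the first `m+1` terms of a sequence to a vector of `ℝⁿ`. -/
def truncate (n m : ℕ) (f : ℕ → ℝ) (i : Fin n) : ℝ := if (i : ℕ) ≤ m then f i else 0

lemma sum_eq_sum_range_of_truncate {m : ℕ} (hmn : m < n) {f : ℕ → ℝ} {g : Fin n → ℝ}
    (hfg : ∀ i : Fin n, g i = truncate n m f i) :
    ∑ i, g i = ∑ j ∈ Finset.range (m + 1), f j := by
  simp only [hfg, truncate]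
  rw [Fin.sum_univ_eq_sum_range (fun i => if i ≤ m then f i else 0) n, ← Finset.sum_filter]
  congr 1
  ext i
  simp
  omega

theorem exists_hard_biaffine {k : ℕ} (hn : k + 2 ≤ n) {R D : ℝ} (hR : 0 < R) (hD : 0 < D)
    (z0 : Pt n) : ∃ L ∈ smoothBiaffine n R, ∃ zs : Pt n,
      IsClosestSaddlePoint L z0 zs ∧ ‖z0 - zs‖ = D ∧
        ∀ A ∈ algSep n, R ^ 2 * ‖z0 - zs‖ ^ 2 / (2 * ((k / 2 : ℕ) : ℝ) + 1) ^ 2 ≤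
          ‖grad L (iterate A L z0 k)‖ ^ 2 := by
  set m := k / 2 with hm
  have hmn : m < n := by omega
  -- Chebyshev nodes as singular values, and `u i ^ 2` equal to `D²` times the dual weights, turn
  -- `‖∇_y L‖²` into `R² D²` times the mean square bounded by duality. The weights sum to one, so
  -- `‖u‖ = D`.
  set τ : Fin n → ℝ := truncate n m (chebNode m) with hτ
  set u : Vec n := WithLp.toLp 2 (truncate n m fun j => D * √(chebWeight m j)) with hu
  have hui : ∀ i, u i = truncate n m (fun j => D * √(chebWeight m j)) i := fun i => rfl
  have h0 : ∀ i, 0 ≤ τ i := fun i => by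
    simp only [hτ, truncate]; split_ifs with h
    exacts [(chebNode_pos h).le, le_rfl]
  have h1 : ∀ i, τ i ≤ 1 := fun i => by
    simp only [hτ, truncate]; split_ifs
    exacts [chebNode_le_one _ _, zero_le_one]
  have hu0 : ∀ i, τ i = 0 → u i = 0 := fun i hi => by
    simp only [hui, hτ, truncate] at hi ⊢
    split_ifs at hi ⊢ with h
    · exact absurd hi (chebNode_pos h).ne'
    · rfl
  have husq : ∀ i, u i ^ 2 = truncate n m (fun j => D ^ 2 * chebWeight m j) i := fun i => by
    simp only [hui, truncate]; split_ifs with h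
    · rw [mul_pow, Real.sq_sqrt (chebWeight_nonneg h)]
    · simp
  have hnorm : ‖z0 - WithLp.toLp 2 (z0.fst - u, z0.snd)‖ = D := by
    rw [← sq_eq_sq₀ (norm_nonneg _) hD.le, sub_toLp_sub, norm_toLp_sq, norm_zero,
      EuclideanSpace.real_norm_sq_eq, sum_eq_sum_range_of_truncate hmn husq, ← Finset.mul_sum,
      sum_chebWeight]
    ring
  have hS := isSmooth_diagSaddle hR.le h0 h1 (WithLp.toLp 2 (z0.fst - u, z0.snd))
  refine ⟨_, ⟨isBiaffine_diagSaddle R τ _, hS⟩, _, isClosestSaddlePoint_diagSaddle hR hu0, hnorm,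
    fun A hA => ?_⟩
  obtain ⟨p, hp, hp0, hle⟩ := exists_poly_le_norm_grad_sq hA hS k
  refine le_trans ?_ hle
  have hsum : ∑ i, u i ^ 2 * (τ i * p.eval (τ i ^ 2)) ^ 2 = D ^ 2 * ∑ j ∈ Finset.range (m + 1),
      chebWeight m j * (chebNode m j * p.eval (chebNode m j ^ 2)) ^ 2 := by
    rw [Finset.mul_sum]
    refine sum_eq_sum_range_of_truncate hmn fun i => ?_
    rw [husq]
    simp only [hτ, truncate]; split_ifs
    · ring
    · simp
  rw [hnorm, hsum, ← mul_assoc, div_eq_mul_one_div]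
  gcongr
  exact chebyshev_mean_sq_lower_bound hp hp0

lemma le_optimalComplexity {k : ℕ} (hn : k + 2 ≤ n) {R D : ℝ} (hR : 0 < R) (hD : 0 < D)
    {𝔄 : Set (Algorithm n)} (h𝔄 : 𝔄 ⊆ algSep n) :
    ENNReal.ofReal (R ^ 2 * D ^ 2 / (2 * ((k / 2 : ℕ) : ℝ) + 1) ^ 2) ≤
      optimalComplexity 𝔄 (smoothBiaffine n R) D k := by
  obtain ⟨L, hL, zs, hzs, hdist, hlow⟩ := exists_hard_biaffine hn hR hD 0
  refine le_iInf₂ fun A hA => ?_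
  refine le_iSup₂_of_le L hL (le_iSup₂_of_le 0 ⟨zs, hzs.1, hdist.le⟩ ?_)
  rw [← hdist]
  exact ENNReal.ofReal_le_ofReal (hlow A (h𝔄 hA))

end

end Minimax

end

theorem theorem3 (k n : ℕ) (hn : k + 2 ≤ n) (R D : ℝ) (hR : 0 < R) (hD : 0 < D) :
    (∀ z0 : Minimax.Pt n, ∃ L ∈ Minimax.smoothBiaffine n R, ∃ zs : Minimax.Pt n,
      Minimax.IsClosestSaddlePoint L z0 zs ∧ ‖z0 - zs‖ = D ∧
        ∀ A ∈ Minimax.algSep n,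
          R ^ 2 * ‖z0 - zs‖ ^ 2 / (2 * ((k / 2 : ℕ) : ℝ) + 1) ^ 2 ≤
            ‖Minimax.grad L (Minimax.iterate A L z0 k)‖ ^ 2) ∧
    Minimax.optimalComplexity (Minimax.algSep n) (Minimax.smoothBiaffine n R) D k =
      ENNReal.ofReal (R ^ 2 * D ^ 2 / (2 * ((k / 2 : ℕ) : ℝ) + 1) ^ 2) ∧
    Minimax.optimalComplexity (Minimax.algSep n ∩ Minimax.algGradientBased n)
        (Minimax.smoothBiaffine n R) D k =
      ENNReal.ofReal (R ^ 2 * D ^ 2 / (2 * ((k / 2 : ℕ) : ℝ) + 1) ^ 2) := by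
  exact ⟨fun z0 => Minimax.exists_hard_biaffine hn hR hD z0,
    le_antisymm ((iInf_le_iInf_of_subset Set.inter_subset_left).trans
      (Minimax.optimalComplexity_le n k hR)) (Minimax.le_optimalComplexity hn hR hD subset_rfl),
    le_antisymm (Minimax.optimalComplexity_le n k hR)
      (Minimax.le_optimalComplexity hn hR hD Set.inter_subset_left)⟩
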